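/- Let $n\ge 1$, let $A\in\mathbb{R}^{n\times n}$ be any matrix and let $\varepsilon>0$. Write $\|X\|$ for the spectral norm and $\|X\|_F$ for the Frobenius norm of a matrix, and let $\mathrm{sr}(A)=\|A\|_F^2/\|A\|^2$ be the stable rank of $A$ (read as $0$ if $A=0$). Let $s\ge 0$ be any integer with $$ s\ \ge\ \frac{28\,n\,\mathrm{sr}(A)\,\ln(\sqrt2\,n)}{\varepsilon^2}, $$ for instance the right-hand side rounded up. Construct the random matrix $\widetilde A$ as follows, with $\epsilon=\varepsilon\|A\|$. Let $\widehat A$ be the matrix $A$ with all entries of absolute value smaller than $\epsilon/(2n)$ replaced by $0$. If $\widehat A\neq 0$, draw $s$ independent, identically distributed index pairs $(i_1,j_1),\dots,(i_s,j_s)$ (with replacement), where $\mathbb{P}\big((i_t,j_t)=(i,j)\big)=p_{ij}:=\widehat A_{ij}^2/\|\widehat A\|_F^2$ for all $1\le i,j\le n$, and let $$ \widetilde A=\frac1s\sum_{t=1}^s\frac{\widehat A_{i_tj_t}}{p_{i_tj_t}}\,e_{i_t}e_{j_t}^T, $$ where $e_1,\dots,e_n$ is the standard basis of $\mathbb{R}^n$.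 If $\widehat A=0$, let $\widetilde A=0$. Then, with probability at least $1-1/n$, $$ \|A-\widetilde A\|\le\varepsilon\|A\|. $$ -/

import Mathlib

open MeasureTheory ProbabilityTheory

noncomputable section

namespace Sparsification

variable {n : ℕ}

/-- The squared Frobenius norm, the sum of the squares of all entries. -/
def frobSq (X : Matrix (Fin n) (Fin n) ℝ) : ℝ := ∑ i, ∑ j, X i j ^ 2

/-- The spectral norm: the operator norm of `X` acting on Euclidean space. -/
def specNorm (X : Matrix (Fin n) (Fin n) ℝ) : ℝ := ‖Matrix.toEuclideanCLM (𝕜 := ℝ) X‖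

/-- The stable rank, the ratio of the squared Frobenius norm to the squared spectral norm. -/
def stableRank (X : Matrix (Fin n) (Fin n) ℝ) : ℝ := frobSq X / specNorm X ^ 2

open Classical in
/-- The truncation of `A` at accuracy `ε`: entries whose absolute value is smaller than
`ε / (2 n)` are replaced by zero, the other ones are kept. -/
def truncate (A : Matrix (Fin n) (Fin n) ℝ) (ε : ℝ) : Matrix (Fin n) (Fin n) ℝ :=
  Matrix.of fun i j => if |A i j| < ε / (2 * n) then 0 else A i j

/-- The sampling probability of the index pair `(i, j)`: the squared entry of the truncated
matrix over its squared Frobenius norm. -/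
def sampProb (A : Matrix (Fin n) (Fin n) ℝ) (ε : ℝ) (i j : Fin n) : ℝ :=
  truncate A ε i j ^ 2 / frobSq (truncate A ε)

/-- `idx 0, …, idx (s - 1)` are the random index pairs drawn by the sampling step: independent
random variables on the probability space `(Ω, μ)`, each equal to `(i, j)` with probability
`sampProb A ε i j`. If the truncated matrix is zero there is no distribution to sample from and
nothing is asked of the law of the pairs: the output below is then zero for every choice. -/
structure IsSample {Ω : Type*} [MeasurableSpace Ω] (μ : Measure Ω)
    (A : Matrix (Fin n) (Fin n) ℝ) (ε : ℝ) {s : ℕ} (idx : Fin s → Ω → Fin n × Fin n) : Prop where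
  measurable : ∀ t, Measurable (idx t)
  indep : iIndepFun idx μ
  law : truncate A ε ≠ 0 → ∀ t i j,
    μ (idx t ⁻¹' {(i, j)}) = ENNReal.ofReal (sampProb A ε i j)

/-- The output of the algorithm on drawn index pairs `(i_t, j_t)`: the average over the `s` trials
of the rescaled sampled entries of the truncated matrix, each put in its own position. -/
def sketch (A : Matrix (Fin n) (Fin n) ℝ) (ε : ℝ) {s : ℕ} (idx : Fin s → Fin n × Fin n) :
    Matrix (Fin n) (Fin n) ℝ :=
  (1 / (s : ℝ)) • ∑ t : Fin s,
    (truncate A ε (idx t).1 (idx t).2 / sampProb A ε (idx t).1 (idx t).2) •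
      Matrix.single (idx t).1 (idx t).2 (1 : ℝ)

end Sparsification

end

/-!
Write `B` for the truncation of `A` and `F` for its squared Frobenius norm. Truncation moves `A` by
at most `e / 2` in Frobenius norm, where `e = ε ‖A‖` (`specNorm_sub_truncate_le`), so it suffices
that the average of the `s` independent centred matrices `deviation B (i_t, j_t)` has spectral norm
at most `e / 2`. Each of them has norm at most `2 n F / e + √F`, since the entries of `B` that can
be drawn are at least `e / (2 n)` (`specNorm_deviation_le`), and second moment at most `n F`
(`posSemidef_second_moment`). The matrix Bernstein inequality (`matrix_bernstein`), applied to the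
Hermitian dilations, which are symmetric of size `2 n`, bounds the failure probability by
`2 n exp (-x)`. The condition on `s`, with `e ≤ 2 n √F`, gives `x ≥ 2 log (√2 n)`
(`two_mul_le_bernstein_exponent`), and the bound is `1 / n`.

The matrix Bernstein inequality is proved by the Laplace transform method of Ahlswede and Winter.
The trace of `exp (θ ∑ Z_t)` is bounded one summand at a time (`sum_prod_mul_trace_exp_le`) by the
Golden–Thompson inequality `tr exp (X + Y) ≤ tr (exp X exp Y)` (`trace_exp_add_le`), and the moment
generating function of one summand is bounded in the Loewner order by diagonalization and the
scalar inequality `exp x ≤ 1 + x + x² / (2 (1 - M / 3))` for `x ≤ M < 3`.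

The Golden–Thompson inequality is the limit, by the Lie–Trotter formula (`tendsto_lie_trotter`), of
`tr ((X Y) ^ N) ≤ tr (X ^ N Y ^ N)` for symmetric `X`, `Y` and `N` a power of two, which follows from
repeated use of the Cauchy–Schwarz inequality for the trace (`trace_pow_two_pow_le`).
-/

noncomputable section

namespace Sparsification

open Matrix Filter Topology

/-! ### The Lie–Trotter formula and the Golden–Thompson inequality -/

section GoldenThompson

section LieTrotter

variable {𝔸 : Type*} [NormedRing 𝔸] [NormOneClass 𝔸]

theorem norm_exp_le_exp_norm [NormedAlgebra ℝ 𝔸] (x : 𝔸) : ‖NormedSpace.exp x‖ ≤ Real.exp ‖x‖ := by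
  have hs : Summable fun k : ℕ => ‖((k.factorial : ℝ)⁻¹) • x ^ k‖ :=
    NormedSpace.norm_expSeries_summable' x
  have hr : Summable fun k : ℕ => ((k.factorial : ℝ)⁻¹) • ‖x‖ ^ k :=
    NormedSpace.expSeries_summable' ‖x‖
  rw [Real.exp_eq_exp_ℝ, NormedSpace.exp_eq_tsum ℝ, NormedSpace.exp_eq_tsum ℝ]
  refine (norm_tsum_le_tsum_norm hs).trans (hs.tsum_le_tsum (fun k => ?_) hr)
  rw [norm_smul, smul_eq_mul, Real.norm_of_nonneg (by positivity)]
  exact mul_le_mul_of_nonneg_left (norm_pow_le x k) (by positivity)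

theorem norm_pow_sub_pow_le {x y : 𝔸} {c : ℝ} (hc : 1 ≤ c) (hx : ‖x‖ ≤ c) (hy : ‖y‖ ≤ c)
    (N : ℕ) : ‖x ^ N - y ^ N‖ ≤ N * c ^ N * ‖x - y‖ := by
  induction N with
  | zero => simp
  | succ N ih =>
    have hxN : ‖x ^ N‖ ≤ c ^ (N + 1) :=
      ((norm_pow_le x N).trans (pow_le_pow_left₀ (norm_nonneg _) hx N)).trans
        (pow_le_pow_right₀ hc N.le_succ)
    calc ‖x ^ (N + 1) - y ^ (N + 1)‖ = ‖x ^ N * (x - y) + (x ^ N - y ^ N) * y‖ := by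
          congr 1; rw [pow_succ, pow_succ]; noncomm_ring
      _ ≤ ‖x ^ N‖ * ‖x - y‖ + ‖x ^ N - y ^ N‖ * ‖y‖ :=
          (norm_add_le _ _).trans (add_le_add (norm_mul_le _ _) (norm_mul_le _ _))
      _ ≤ c ^ (N + 1) * ‖x - y‖ + (N * c ^ N * ‖x - y‖) * c := by gcongr
      _ = ((N + 1 : ℕ) : ℝ) * c ^ (N + 1) * ‖x - y‖ := by push_cast; ring

/-- The **Lie–Trotter product formula**. The curves `t ↦ exp (t a) exp (t b)` and
`t ↦ exp (t (a + b))` agree to first order at `0`, so that their `N`-th powers at `t = 1 / N`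
differ by `o(1)`. -/
theorem tendsto_lie_trotter [NormedAlgebra ℝ 𝔸] [CompleteSpace 𝔸] (a b : 𝔸) :
    Tendsto (fun N : ℕ => (NormedSpace.exp ((N : ℝ)⁻¹ • a) * NormedSpace.exp ((N : ℝ)⁻¹ • b)) ^ N)
      atTop (𝓝 (NormedSpace.exp (a + b))) := by
  set f : ℝ → 𝔸 := fun t => NormedSpace.exp (t • a) * NormedSpace.exp (t • b) -
    NormedSpace.exp (t • (a + b)) with hf
  have hf0 : f 0 = 0 := by simp [hf]
  have hd : HasDerivAt f 0 0 := by
    have h := ((hasDerivAt_exp_smul_const (𝕂 := ℝ) a 0).mul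
      (hasDerivAt_exp_smul_const (𝕂 := ℝ) b 0)).sub (hasDerivAt_exp_smul_const (𝕂 := ℝ) (a + b) 0)
    simp only [zero_smul, NormedSpace.exp_zero, one_mul, mul_one, sub_self] at h
    exact h
  have ht0 : Tendsto (fun N : ℕ => (N : ℝ)⁻¹) atTop (𝓝[≠] 0) := by
    refine tendsto_nhdsWithin_iff.2 ⟨tendsto_inv_atTop_nhds_zero_nat, ?_⟩
    filter_upwards [eventually_gt_atTop 0] with N hN
    simp only [Set.mem_compl_iff, Set.mem_singleton_iff, inv_eq_zero, Nat.cast_eq_zero]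
    omega
  have hsl : Tendsto (fun N : ℕ => (N : ℝ) * ‖f (N : ℝ)⁻¹‖) atTop (𝓝 0) := by
    have h := ((hasDerivAt_iff_tendsto_slope.1 hd).comp ht0).norm
    refine (by simpa using h : Tendsto _ _ (𝓝 (0 : ℝ))).congr fun N => ?_
    simp [slope_def_module, hf0, norm_smul]
  set K : ℝ := ‖a‖ + ‖b‖
  rw [tendsto_iff_norm_sub_tendsto_zero]
  refine squeeze_zero' (Eventually.of_forall fun _ => norm_nonneg _) ?_
    (by simpa using hsl.const_mul (Real.exp K))
  filter_upwards [eventually_gt_atTop 0] with N hN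
  have hN' : (N : ℝ) ≠ 0 := by exact_mod_cast hN.ne'
  have hpow : NormedSpace.exp ((N : ℝ)⁻¹ • (a + b)) ^ N = NormedSpace.exp (a + b) := by
    let +nondep : NormedAlgebra ℚ 𝔸 := .restrictScalars ℚ ℝ 𝔸
    rw [← NormedSpace.exp_nsmul, ← Nat.cast_smul_eq_nsmul ℝ, smul_smul, mul_inv_cancel₀ hN',
      one_smul]
  have hn : ∀ x : 𝔸, ‖(N : ℝ)⁻¹ • x‖ = (N : ℝ)⁻¹ * ‖x‖ := fun x => by
    rw [norm_smul, Real.norm_of_nonneg (by positivity)]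
  have h1 : ‖NormedSpace.exp ((N : ℝ)⁻¹ • a) * NormedSpace.exp ((N : ℝ)⁻¹ • b)‖
      ≤ Real.exp ((N : ℝ)⁻¹ * K) := by
    refine (norm_mul_le _ _).trans ((mul_le_mul (norm_exp_le_exp_norm _) (norm_exp_le_exp_norm _)
      (norm_nonneg _) (Real.exp_nonneg _)).trans_eq ?_)
    rw [← Real.exp_add, hn, hn]; congr 1; ring
  have h2 : ‖NormedSpace.exp ((N : ℝ)⁻¹ • (a + b))‖ ≤ Real.exp ((N : ℝ)⁻¹ * K) := by
    refine (norm_exp_le_exp_norm _).trans (Real.exp_le_exp.2 ?_)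
    rw [hn]
    exact mul_le_mul_of_nonneg_left (norm_add_le a b) (by positivity)
  have h3 := norm_pow_sub_pow_le (Real.one_le_exp (by positivity)) h1 h2 N
  rw [hpow, ← Real.exp_nat_mul, mul_inv_cancel_left₀ hN'] at h3
  exact h3.trans_eq (by simp only [hf]; ring)

end LieTrotter

variable {m : Type*} [Fintype m]

/-- Cauchy–Schwarz for the Hilbert–Schmidt inner product, in arithmetic mean form. -/
theorem two_mul_trace_mul_le (X Y : Matrix m m ℝ) :
    2 * (X * Y).trace ≤ (Xᵀ * X).trace + (Y * Yᵀ).trace := by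
  have h : 0 ≤ ((X - Yᵀ)ᴴ * (X - Yᵀ)).trace :=
    (posSemidef_conjTranspose_mul_self (X - Yᵀ)).trace_nonneg
  rw [conjTranspose_eq_transpose_of_trivial, transpose_sub, transpose_transpose, sub_mul, mul_sub,
    mul_sub, trace_sub, trace_sub, trace_sub, trace_mul_comm Y X, ← trace_transpose (Xᵀ * Yᵀ),
    transpose_mul, transpose_transpose, transpose_transpose, trace_mul_comm Y X] at h
  linarith

variable [DecidableEq m]

theorem trace_mul_pow_comm (X Y : Matrix m m ℝ) (N : ℕ) :
    ((X * Y) ^ N).trace = ((Y * X) ^ N).trace := by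
  cases N with
  | zero => simp
  | succ N =>
    have h : (X * Y) ^ N * X = X * (Y * X) ^ N :=
      ((show SemiconjBy X (Y * X) (X * Y) by simp [SemiconjBy, mul_assoc]).pow_right N).symm
    rw [pow_succ, ← mul_assoc, h, mul_assoc, trace_mul_comm, mul_assoc, ← pow_succ]

/-- Two trace inequalities for powers with exponent a power of two. Each follows from the pair of
them at the preceding exponent: squaring doubles the exponent, and `trace_mul_pow_comm` brings
the symmetric factors together. -/
theorem trace_pow_two_pow_le (k : ℕ) :
    (∀ X : Matrix m m ℝ, (X ^ 2 ^ (k + 1)).trace ≤ ((Xᵀ * X) ^ 2 ^ k).trace) ∧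
    ∀ X Y : Matrix m m ℝ, Xᵀ = X → Yᵀ = Y →
      ((X * Y) ^ 2 ^ k).trace ≤ (X ^ 2 ^ k * Y ^ 2 ^ k).trace := by
  induction k with
  | zero =>
    refine ⟨fun X => ?_, fun X Y _ _ => by simp⟩
    have h := two_mul_trace_mul_le X X
    rw [trace_mul_comm X Xᵀ] at h
    simp only [zero_add, pow_one, pow_zero, sq]
    linarith
  | succ k ih =>
    obtain ⟨ihC, ihG⟩ := ih
    have hpow : ∀ W : Matrix m m ℝ, W ^ 2 ^ (k + 1) = (W * W) ^ 2 ^ k := fun W => by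
      rw [← sq, ← pow_mul, pow_succ']
    refine ⟨fun X => ?_, fun X Y hX hY => ?_⟩
    · have hP : (Xᵀ * X)ᵀ = Xᵀ * X := by simp
      have hQ : (X * Xᵀ)ᵀ = X * Xᵀ := by simp
      have hsq : ∀ W : Matrix m m ℝ, W ^ 2 ^ k * W ^ 2 ^ k = W ^ 2 ^ (k + 1) := fun W => by
        rw [← pow_add, pow_succ, mul_two]
      calc (X ^ 2 ^ (k + 1 + 1)).trace = ((X * X) ^ 2 ^ (k + 1)).trace := by
            rw [← sq, ← pow_mul, ← pow_succ']
        _ ≤ (((X * X)ᵀ * (X * X)) ^ 2 ^ k).trace := ihC _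
        _ = (((Xᵀ * X) * (X * Xᵀ)) ^ 2 ^ k).trace := by
            rw [transpose_mul, mul_assoc, trace_mul_pow_comm]; simp only [mul_assoc]
        _ ≤ ((Xᵀ * X) ^ 2 ^ k * (X * Xᵀ) ^ 2 ^ k).trace := ihG _ _ hP hQ
        _ ≤ ((Xᵀ * X) ^ 2 ^ (k + 1)).trace := by
            have h := two_mul_trace_mul_le ((Xᵀ * X) ^ 2 ^ k) ((X * Xᵀ) ^ 2 ^ k)
            rw [transpose_pow, transpose_pow, hP, hQ, hsq, hsq, trace_mul_pow_comm X Xᵀ] at h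
            linarith
    · calc ((X * Y) ^ 2 ^ (k + 1)).trace ≤ (((X * Y)ᵀ * (X * Y)) ^ 2 ^ k).trace := ihC _
        _ = (((X * X) * (Y * Y)) ^ 2 ^ k).trace := by
            rw [transpose_mul, hX, hY, mul_assoc, trace_mul_pow_comm]; simp only [mul_assoc]
        _ ≤ ((X * X) ^ 2 ^ k * (Y * Y) ^ 2 ^ k).trace :=
            ihG _ _ (by rw [transpose_mul, hX]) (by rw [transpose_mul, hY])
        _ = (X ^ 2 ^ (k + 1) * Y ^ 2 ^ (k + 1)).trace := by rw [hpow, hpow]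

theorem tendsto_lie_trotter_matrix [Nonempty m] (X Y : Matrix m m ℝ) :
    Tendsto (fun N : ℕ => (NormedSpace.exp ((N : ℝ)⁻¹ • X) * NormedSpace.exp ((N : ℝ)⁻¹ • Y)) ^ N)
      atTop (𝓝 (NormedSpace.exp (X + Y))) :=
  open scoped Norms.Operator in tendsto_lie_trotter X Y

/-- The **Golden–Thompson inequality** for real symmetric matrices. -/
theorem trace_exp_add_le (X Y : Matrix m m ℝ) (hX : Xᵀ = X) (hY : Yᵀ = Y) :
    (NormedSpace.exp (X + Y)).trace ≤ (NormedSpace.exp X * NormedSpace.exp Y).trace := by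
  cases isEmpty_or_nonempty m
  · simp [trace]
  have hlim := ((tendsto_lie_trotter_matrix X Y).comp
    (tendsto_pow_atTop_atTop_of_one_lt one_lt_two))
  have htr : Tendsto (fun k : ℕ => _) atTop (𝓝 (NormedSpace.exp (X + Y)).trace) :=
    ((continuous_id.matrix_trace).tendsto _).comp hlim
  refine le_of_tendsto' htr fun k => ?_
  have hN : ((2 ^ k : ℕ) : ℝ) ≠ 0 := by positivity
  have hpow : ∀ W : Matrix m m ℝ,
      NormedSpace.exp (((2 ^ k : ℕ) : ℝ)⁻¹ • W) ^ 2 ^ k = NormedSpace.exp W := fun W => by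
    rw [← Matrix.exp_nsmul, ← Nat.cast_smul_eq_nsmul ℝ, smul_smul, mul_inv_cancel₀ hN, one_smul]
  have h := (trace_pow_two_pow_le (m := m) k).2 (NormedSpace.exp (((2 ^ k : ℕ) : ℝ)⁻¹ • X))
    (NormedSpace.exp (((2 ^ k : ℕ) : ℝ)⁻¹ • Y))
    (by rw [← Matrix.exp_transpose, transpose_smul, hX])
    (by rw [← Matrix.exp_transpose, transpose_smul, hY])
  rwa [hpow, hpow] at h

end GoldenThompson

/-! ### The matrix Bernstein inequality -/

section MatrixBernstein

/-- Bernstein's estimate of the exponential with the denominator `1 - x / 3` cleared. The second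
derivative of the difference of the two sides is `(1 - (1 - x) exp x) / 3 ≥ 0`, and the difference
vanishes to first order at `0`. -/
theorem one_sub_div_three_mul_exp_le (x : ℝ) :
    (1 - x / 3) * Real.exp x ≤ 1 + 2 * x / 3 + x ^ 2 / 6 := by
  set g : ℝ → ℝ := fun y => 2 + y - (2 - y) * Real.exp y
  have hg : ∀ y, HasDerivAt g (1 - (1 - y) * Real.exp y) y := fun y => by
    have h := ((hasDerivAt_id y).const_add 2).sub
      (((hasDerivAt_id y).const_sub 2).mul (Real.hasDerivAt_exp y))
    refine h.congr_deriv ?_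
    simp only [id_eq]; ring
  have hgm : Monotone g := by
    refine monotone_of_deriv_nonneg (fun y => (hg y).differentiableAt) fun y => ?_
    rw [(hg y).deriv, sub_nonneg]
    calc (1 - y) * Real.exp y ≤ Real.exp (-y) * Real.exp y := by
          gcongr
          have := Real.add_one_le_exp (-y)
          linarith
      _ = 1 := by rw [← Real.exp_add]; simp
  have hg0 : g 0 = 0 := by simp [g]
  set u : ℝ → ℝ := fun y => 1 + 2 * y / 3 + y ^ 2 / 6 - (1 - y / 3) * Real.exp y
  have hu : ∀ y, HasDerivAt u (g y / 3) y := fun y => by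
    have h := (((((hasDerivAt_id y).const_mul 2).div_const 3).const_add 1).add
      (((hasDerivAt_id y).pow 2).div_const 6)).sub
      ((((hasDerivAt_id y).div_const 3).const_sub 1).mul (Real.hasDerivAt_exp y))
    refine h.congr_deriv ?_
    simp only [id_eq, g]; norm_num; ring
  have hu0 : u 0 = 0 := by simp [u]
  have hud : Differentiable ℝ u := fun y => (hu y).differentiableAt
  suffices 0 ≤ u x by simp only [u] at this; linarith
  rcases le_total 0 x with hx | hx
  · have hm : MonotoneOn u (Set.Ici 0) := by
      refine monotoneOn_of_deriv_nonneg (convex_Ici 0) hud.continuous.continuousOn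
        hud.differentiableOn fun y hy => ?_
      rw [interior_Ici] at hy
      rw [(hu y).deriv]
      have := hgm (le_of_lt (Set.mem_Ioi.1 hy))
      linarith
    exact hu0 ▸ hm (Set.mem_Ici.2 le_rfl) (Set.mem_Ici.2 hx) hx
  · have hm : AntitoneOn u (Set.Iic 0) := by
      refine antitoneOn_of_deriv_nonpos (convex_Iic 0) hud.continuous.continuousOn
        hud.differentiableOn fun y hy => ?_
      rw [interior_Iic] at hy
      rw [(hu y).deriv]
      have := hgm (le_of_lt (Set.mem_Iio.1 hy))
      linarith
    exact hu0 ▸ hm (Set.mem_Iic.2 hx) (Set.mem_Iic.2 le_rfl) hx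

theorem exp_le_bernstein {x M : ℝ} (hxM : x ≤ M) (hM : M < 3) :
    Real.exp x ≤ 1 + x + 1 / (2 * (1 - M / 3)) * x ^ 2 := by
  have hx : 0 < 1 - x / 3 := by linarith
  have hM' : 0 < 1 - M / 3 := by linarith
  have h1 : Real.exp x ≤ 1 + x + 1 / (2 * (1 - x / 3)) * x ^ 2 := by
    have h := one_sub_div_three_mul_exp_le x
    rw [mul_comm, ← le_div_iff₀ hx] at h
    refine h.trans_eq ?_
    rw [div_eq_iff hx.ne']
    have : 1 / (2 * (1 - x / 3)) * (1 - x / 3) = 1 / 2 := by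
      rw [one_div_mul_eq_div, div_eq_div_iff (by positivity) two_ne_zero]; ring
    linear_combination -x ^ 2 * this
  have h2 : 1 / (2 * (1 - x / 3)) ≤ 1 / (2 * (1 - M / 3)) :=
    one_div_le_one_div_of_le (by linarith) (by linarith)
  nlinarith [sq_nonneg x]

variable {m : Type*} [Fintype m] [DecidableEq m]

/-- A real symmetric matrix is orthogonally diagonalizable, and its exponential is diagonal in the
same basis. -/
theorem exists_orthogonal_diagonalization {Z : Matrix m m ℝ} (hZ : Zᵀ = Z) :
    ∃ (U : Matrix m m ℝ) (d : m → ℝ), U * Uᵀ = 1 ∧ Uᵀ * U = 1 ∧ Z = U * diagonal d * Uᵀ ∧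
      NormedSpace.exp Z = U * diagonal (fun i => Real.exp (d i)) * Uᵀ := by
  have hH : Z.IsHermitian := by rw [IsHermitian, conjTranspose_eq_transpose_of_trivial, hZ]
  set U : Matrix m m ℝ := ↑hH.eigenvectorUnitary
  have hs : star U = Uᵀ := by rw [star_eq_conjTranspose, conjTranspose_eq_transpose_of_trivial]
  have h1 : U * Uᵀ = 1 := by rw [← hs]; exact Unitary.coe_mul_star_self _
  have h2 : Uᵀ * U = 1 := by rw [← hs]; exact Unitary.coe_star_mul_self _
  have hZd : Z = U * diagonal hH.eigenvalues * Uᵀ := by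
    have h := hH.spectral_theorem
    rw [Unitary.conjStarAlgAut_apply] at h
    rw [← hs]
    exact h
  refine ⟨U, hH.eigenvalues, h1, h2, hZd, ?_⟩
  have hinv : U⁻¹ = Uᵀ := inv_eq_right_inv h1
  have hunit : IsUnit U := ⟨⟨U, Uᵀ, h1, h2⟩, rfl⟩
  conv_lhs => rw [hZd, ← hinv, Matrix.exp_conj _ _ hunit, Matrix.exp_diagonal, hinv]
  congr 3
  funext i
  rw [Pi.coe_exp, Real.exp_eq_exp_ℝ]

theorem trace_conj_diagonal {U : Matrix m m ℝ} (hU : Uᵀ * U = 1) (d : m → ℝ) :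
    (U * diagonal d * Uᵀ).trace = ∑ i, d i := by
  rw [trace_mul_comm, ← mul_assoc, hU, one_mul, trace_diagonal]

theorem posSemidef_conj_diagonal (U : Matrix m m ℝ) {d : m → ℝ} (hd : ∀ i, 0 ≤ d i) :
    (U * diagonal d * Uᵀ).PosSemidef := by
  have h := (PosSemidef.diagonal (R := ℝ) (d := d) hd).mul_mul_conjTranspose_same U
  rwa [conjTranspose_eq_transpose_of_trivial] at h

theorem smul_one_eq_conj {U : Matrix m m ℝ} (hU : U * Uᵀ = 1) (c : ℝ) :
    c • (1 : Matrix m m ℝ) = U * diagonal (fun _ => c) * Uᵀ := by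
  rw [← smul_one_eq_diagonal, Matrix.mul_smul, mul_one, Matrix.smul_mul, hU]

/-- The bound `Z ≤ c` in the Loewner order is a bound on the eigenvalues. -/
theorem posSemidef_smul_one_sub_conj_iff {U : Matrix m m ℝ} (h1 : U * Uᵀ = 1) (h2 : Uᵀ * U = 1)
    (d : m → ℝ) (c : ℝ) :
    (c • (1 : Matrix m m ℝ) - U * diagonal d * Uᵀ).PosSemidef ↔ ∀ i, d i ≤ c := by
  have he : c • (1 : Matrix m m ℝ) - U * diagonal d * Uᵀ
      = U * diagonal (fun i => c - d i) * Uᵀ := by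
    rw [smul_one_eq_conj h1, ← sub_mul, ← mul_sub, diagonal_sub]
  rw [he]
  refine ⟨fun h i => ?_, fun h => posSemidef_conj_diagonal U fun i => sub_nonneg.2 (h i)⟩
  have h' := h.conjTranspose_mul_mul_same U
  have he' : Uᴴ * (U * diagonal (fun i => c - d i) * Uᵀ) * U = diagonal (fun i => c - d i) := by
    rw [conjTranspose_eq_transpose_of_trivial]
    calc _ = (Uᵀ * U) * diagonal (fun i => c - d i) * (Uᵀ * U) := by simp only [mul_assoc]
      _ = _ := by rw [h2, one_mul, mul_one]
  rw [he'] at h'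
  exact sub_nonneg.1 (posSemidef_diagonal_iff.1 h' i)

/-- Bernstein's estimate of the exponential in the Loewner order. -/
theorem posSemidef_bernstein_sub_exp {Z : Matrix m m ℝ} (hZ : Zᵀ = Z) {M : ℝ} (hM : M < 3)
    (hZM : (M • (1 : Matrix m m ℝ) - Z).PosSemidef) :
    (1 + Z + (1 / (2 * (1 - M / 3))) • (Z * Z) - NormedSpace.exp Z).PosSemidef := by
  obtain ⟨U, d, h1, h2, hd, he⟩ := exists_orthogonal_diagonalization hZ
  rw [hd, posSemidef_smul_one_sub_conj_iff h1 h2] at hZM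
  set c := 1 / (2 * (1 - M / 3))
  have hZZ : Z * Z = U * diagonal (fun i => d i ^ 2) * Uᵀ := by
    calc Z * Z = U * diagonal d * (Uᵀ * U) * diagonal d * Uᵀ := by
          conv_lhs => rw [hd]
          simp only [mul_assoc]
      _ = _ := by rw [h2, mul_one, mul_assoc U, diagonal_mul_diagonal]; simp only [sq]
  have key : 1 + Z + c • (Z * Z) - NormedSpace.exp Z =
      U * diagonal (fun i => 1 + d i + c * d i ^ 2 - Real.exp (d i)) * Uᵀ := by
    have hone : (1 : Matrix m m ℝ) = U * diagonal (fun _ => (1 : ℝ)) * Uᵀ := by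
      simpa using smul_one_eq_conj h1 1
    rw [he, hZZ, hone]
    conv_lhs => enter [1, 1, 2]; rw [hd]
    have hc : c • (U * diagonal (fun i => d i ^ 2) * Uᵀ) =
        U * diagonal (fun i => c * d i ^ 2) * Uᵀ := by
      rw [← Matrix.smul_mul, ← Matrix.mul_smul, ← diagonal_smul]; rfl
    rw [hc]
    simp only [← add_mul, ← sub_mul, ← mul_add, ← mul_sub, diagonal_add, diagonal_sub]
  rw [key]
  exact posSemidef_conj_diagonal U fun i => sub_nonneg.2 (exp_le_bernstein (hZM i) hM)

/-- The trace exponential dominates the exponential of the largest eigenvalue. -/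
theorem exp_le_trace_exp {S : Matrix m m ℝ} (hS : Sᵀ = S) {τ : ℝ}
    (h : ¬ (τ • (1 : Matrix m m ℝ) - S).PosSemidef) :
    Real.exp τ ≤ (NormedSpace.exp S).trace := by
  obtain ⟨U, d, h1, h2, hd, he⟩ := exists_orthogonal_diagonalization hS
  rw [hd, posSemidef_smul_one_sub_conj_iff h1 h2] at h
  push Not at h
  obtain ⟨i, hi⟩ := h
  rw [he, trace_conj_diagonal h2]
  exact (Real.exp_le_exp.2 hi.le).trans
    (Finset.single_le_sum (f := fun i => Real.exp (d i)) (fun j _ => Real.exp_nonneg _)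
      (Finset.mem_univ i))

theorem trace_exp_nonneg {S : Matrix m m ℝ} (hS : Sᵀ = S) : 0 ≤ (NormedSpace.exp S).trace := by
  obtain ⟨U, d, -, h2, -, he⟩ := exists_orthogonal_diagonalization hS
  rw [he, trace_conj_diagonal h2]
  exact Finset.sum_nonneg fun i _ => Real.exp_nonneg _

/-- The trace of `Q exp S` is monotone in `Q`: after conjugation by the symmetric matrix
`exp (S / 2)` the difference `g - Q` stays positive semidefinite. -/
theorem trace_mul_exp_le {Q S : Matrix m m ℝ} (hS : Sᵀ = S) {g : ℝ}
    (hQ : (g • (1 : Matrix m m ℝ) - Q).PosSemidef) :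
    (Q * NormedSpace.exp S).trace ≤ g * (NormedSpace.exp S).trace := by
  set R : Matrix m m ℝ := NormedSpace.exp ((2 : ℝ)⁻¹ • S)
  have hR : Rᵀ = R := by rw [← Matrix.exp_transpose, transpose_smul, hS]
  have hRR : R * R = NormedSpace.exp S := by
    rw [← Matrix.exp_add_of_commute _ _ (Commute.refl _), ← add_smul]
    norm_num
  have h := (hQ.mul_mul_conjTranspose_same R).trace_nonneg
  rw [conjTranspose_eq_transpose_of_trivial, hR, trace_mul_comm, ← mul_assoc, hRR, trace_mul_comm,
    sub_mul, Matrix.smul_mul, one_mul, trace_sub, trace_smul, smul_eq_mul] at h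
  linarith

section Bernstein

variable {ι : Type*} [Fintype ι]

/-- The iteration of Ahlswede and Winter: the Golden–Thompson inequality peels off one summand at a
time, and each contributes a factor `g` to the trace moment generating function. -/
theorem sum_prod_mul_trace_exp_le {p : ι → ℝ} (hp : ∀ i, 0 ≤ p i) {W : ι → Matrix m m ℝ}
    (hW : ∀ i, (W i)ᵀ = W i) {g : ℝ} (hg : 0 ≤ g)
    (hmgf : (g • (1 : Matrix m m ℝ) - ∑ i, p i • NormedSpace.exp (W i)).PosSemidef) (s : ℕ) :
    ∑ f : Fin s → ι, (∏ t, p (f t)) * (NormedSpace.exp (∑ t, W (f t))).trace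
      ≤ g ^ s * Fintype.card m := by
  induction s with
  | zero => simp [trace_one]
  | succ s ih =>
    have hsym : ∀ f : Fin s → ι, (∑ t, W (f t))ᵀ = ∑ t, W (f t) := fun f => by
      rw [transpose_sum]; exact Finset.sum_congr rfl fun t _ => hW _
    calc ∑ f : Fin (s + 1) → ι, (∏ t, p (f t)) * (NormedSpace.exp (∑ t, W (f t))).trace
        = ∑ f : Fin s → ι, ∑ i, (p i * ∏ t, p (f t)) *
            (NormedSpace.exp (W i + ∑ t, W (f t))).trace := by
          rw [← (Fin.consEquiv fun _ => ι).sum_comp, Fintype.sum_prod_type, Finset.sum_comm]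
          simp [Fin.consEquiv, Fin.prod_univ_succ, Fin.sum_univ_succ]
      _ ≤ ∑ f : Fin s → ι, ∑ i, (p i * ∏ t, p (f t)) *
            (NormedSpace.exp (W i) * NormedSpace.exp (∑ t, W (f t))).trace := by
          refine Finset.sum_le_sum fun f _ => Finset.sum_le_sum fun i _ => ?_
          exact mul_le_mul_of_nonneg_left (trace_exp_add_le _ _ (hW i) (hsym f))
            (mul_nonneg (hp i) (Finset.prod_nonneg fun t _ => hp _))
      _ = ∑ f : Fin s → ι, (∏ t, p (f t)) *
            ((∑ i, p i • NormedSpace.exp (W i)) * NormedSpace.exp (∑ t, W (f t))).trace := by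
          refine Finset.sum_congr rfl fun f _ => ?_
          rw [Finset.sum_mul, trace_sum, Finset.mul_sum]
          refine Finset.sum_congr rfl fun i _ => ?_
          rw [Matrix.smul_mul, trace_smul, smul_eq_mul]
          ring
      _ ≤ ∑ f : Fin s → ι, (∏ t, p (f t)) *
            (g * (NormedSpace.exp (∑ t, W (f t))).trace) := by
          refine Finset.sum_le_sum fun f _ => ?_
          exact mul_le_mul_of_nonneg_left (trace_mul_exp_le (hsym f) hmgf)
            (Finset.prod_nonneg fun t _ => hp _)
      _ = g * ∑ f : Fin s → ι, (∏ t, p (f t)) * (NormedSpace.exp (∑ t, W (f t))).trace := by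
          rw [Finset.mul_sum]
          exact Finset.sum_congr rfl fun f _ => by ring
      _ ≤ g * (g ^ s * Fintype.card m) := mul_le_mul_of_nonneg_left ih hg
      _ = g ^ (s + 1) * Fintype.card m := by ring

/-- The moment generating function of a centred random symmetric matrix with `Z ≤ M` and second
moment at most `v`. -/
theorem posSemidef_exp_sub_mgf {p : ι → ℝ} (hp : ∀ i, 0 ≤ p i) (hp1 : ∑ i, p i = 1)
    {Z : ι → Matrix m m ℝ} (hZ : ∀ i, (Z i)ᵀ = Z i) (hmean : ∑ i, p i • Z i = 0) {M v θ : ℝ}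
    (hM : ∀ i, (M • (1 : Matrix m m ℝ) - Z i).PosSemidef)
    (hv : (v • (1 : Matrix m m ℝ) - ∑ i, p i • (Z i * Z i)).PosSemidef)
    (hθ : 0 ≤ θ) (hθM : θ * M < 3) :
    (Real.exp (v * θ ^ 2 / (2 * (1 - θ * M / 3))) • (1 : Matrix m m ℝ) -
      ∑ i, p i • NormedSpace.exp (θ • Z i)).PosSemidef := by
  set c := 1 / (2 * (1 - θ * M / 3)) with hc
  have hc0 : 0 ≤ c := by
    have : 0 < 1 - θ * M / 3 := by linarith
    positivity
  have h1 : (∑ i, p i • (1 + θ • Z i + c • ((θ • Z i) * (θ • Z i)) -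
      NormedSpace.exp (θ • Z i))).PosSemidef := by
    refine posSemidef_sum _ fun i _ => (posSemidef_bernstein_sub_exp ?_ hθM ?_).smul (hp i)
    · rw [transpose_smul, hZ]
    · have := (hM i).smul hθ
      rwa [smul_sub, smul_smul] at this
  have h2 := hv.smul (mul_nonneg hc0 (sq_nonneg θ))
  have h3 : ((Real.exp (c * θ ^ 2 * v) - (1 + c * θ ^ 2 * v)) • (1 : Matrix m m ℝ)).PosSemidef :=
    PosSemidef.one.smul (by have := Real.add_one_le_exp (c * θ ^ 2 * v); linarith)
  have key : Real.exp (v * θ ^ 2 / (2 * (1 - θ * M / 3))) • (1 : Matrix m m ℝ) -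
      ∑ i, p i • NormedSpace.exp (θ • Z i) =
      (∑ i, p i • (1 + θ • Z i + c • ((θ • Z i) * (θ • Z i)) - NormedSpace.exp (θ • Z i))) +
      (c * θ ^ 2) • (v • (1 : Matrix m m ℝ) - ∑ i, p i • (Z i * Z i)) +
      (Real.exp (c * θ ^ 2 * v) - (1 + c * θ ^ 2 * v)) • (1 : Matrix m m ℝ) := by
    have e0 : v * θ ^ 2 / (2 * (1 - θ * M / 3)) = c * θ ^ 2 * v := by rw [hc]; ring
    have e1 : ∑ i, p i • (θ • Z i) = 0 := by
      rw [← smul_zero θ, ← hmean, Finset.smul_sum]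
      exact Finset.sum_congr rfl fun i _ => smul_comm _ _ _
    have e2 : ∑ i, p i • (c • ((θ • Z i) * (θ • Z i))) = (c * θ ^ 2) • ∑ i, p i • (Z i * Z i) := by
      rw [Finset.smul_sum]
      refine Finset.sum_congr rfl fun i _ => ?_
      rw [Matrix.smul_mul, Matrix.mul_smul]
      module
    have e3 : ∑ i, p i • (1 : Matrix m m ℝ) = 1 := by rw [← Finset.sum_smul, hp1, one_smul]
    simp only [smul_sub, smul_add, Finset.sum_sub_distrib, Finset.sum_add_distrib, e0, e1, e2, e3]
    rw [smul_smul, sub_smul, add_smul, one_smul]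
    abel
  rw [key]
  exact (h1.add h2).add h3

open Classical in
/-- The **matrix Bernstein inequality** for the upper tail of a sum of `s` independent copies of a
random symmetric matrix `Z` with finitely many values. -/
theorem matrix_bernstein {p : ι → ℝ} (hp : ∀ i, 0 ≤ p i) (hp1 : ∑ i, p i = 1)
    {Z : ι → Matrix m m ℝ} (hZ : ∀ i, (Z i)ᵀ = Z i) (hmean : ∑ i, p i • Z i = 0) {M v τ : ℝ}
    (hM : ∀ i, (M • (1 : Matrix m m ℝ) - Z i).PosSemidef)
    (hv : (v • (1 : Matrix m m ℝ) - ∑ i, p i • (Z i * Z i)).PosSemidef) {s : ℕ}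
    (hM0 : 0 ≤ M) (hv0 : 0 < v) (hs : 0 < s) (hτ : 0 < τ) :
    ∑ f : Fin s → ι, (∏ t, p (f t)) *
      (if (τ • (1 : Matrix m m ℝ) - ∑ t, Z (f t)).PosSemidef then 0 else 1)
      ≤ Fintype.card m * Real.exp (-(τ ^ 2 / (2 * (s * v + M * τ / 3)))) := by
  have hs' : (0 : ℝ) < s := by exact_mod_cast hs
  have hsv : 0 < s * v := by positivity
  have hD : 0 < s * v + M * τ / 3 := by positivity
  -- with this `θ` the exponent `-θ τ + s v θ² / (2 (1 - θ M / 3))` of the Laplace transform bound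
  -- is half of `-θ τ`, which is Bernstein's exponent
  set θ : ℝ := τ / (s * v + M * τ / 3) with hθ
  have hθ0 : 0 < θ := by positivity
  have h1 : 1 - θ * M / 3 = s * v / (s * v + M * τ / 3) := by
    rw [hθ]; field_simp; ring
  have hθM : θ * M < 3 := by
    have : 0 < 1 - θ * M / 3 := by rw [h1]; positivity
    linarith
  have hmgf := posSemidef_exp_sub_mgf hp hp1 hZ hmean hM hv hθ0.le hθM
  have hsymθ : ∀ i, (θ • Z i)ᵀ = θ • Z i := fun i => by rw [transpose_smul, hZ]
  have hsum := sum_prod_mul_trace_exp_le hp hsymθ (Real.exp_nonneg _) hmgf s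
  have hmarkov : ∀ f : Fin s → ι,
      (if (τ • (1 : Matrix m m ℝ) - ∑ t, Z (f t)).PosSemidef then (0 : ℝ) else 1) ≤
        Real.exp (-(θ * τ)) * (NormedSpace.exp (∑ t, θ • Z (f t))).trace := by
    intro f
    have hsym : (∑ t, θ • Z (f t))ᵀ = ∑ t, θ • Z (f t) := by
      rw [transpose_sum]; exact Finset.sum_congr rfl fun t _ => hsymθ _
    split_ifs with h
    · exact mul_nonneg (Real.exp_nonneg _) (trace_exp_nonneg hsym)
    · rw [Real.exp_neg, inv_mul_eq_div, le_div_iff₀ (Real.exp_pos _), one_mul]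
      refine exp_le_trace_exp hsym fun h' => h ?_
      have := h'.smul (inv_nonneg.2 hθ0.le)
      rwa [← Finset.smul_sum, smul_sub, smul_smul, smul_smul, ← mul_assoc,
        inv_mul_cancel₀ hθ0.ne', one_mul, one_smul] at this
  calc _ ≤ ∑ f : Fin s → ι, (∏ t, p (f t)) *
        (Real.exp (-(θ * τ)) * (NormedSpace.exp (∑ t, θ • Z (f t))).trace) :=
        Finset.sum_le_sum fun f _ =>
          mul_le_mul_of_nonneg_left (hmarkov f) (Finset.prod_nonneg fun t _ => hp _)
    _ = Real.exp (-(θ * τ)) *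
        ∑ f : Fin s → ι, (∏ t, p (f t)) * (NormedSpace.exp (∑ t, θ • Z (f t))).trace := by
        rw [Finset.mul_sum]
        exact Finset.sum_congr rfl fun f _ => by ring
    _ ≤ Real.exp (-(θ * τ)) *
        (Real.exp (v * θ ^ 2 / (2 * (1 - θ * M / 3))) ^ s * Fintype.card m) :=
        mul_le_mul_of_nonneg_left hsum (Real.exp_nonneg _)
    _ = Fintype.card m * Real.exp (-(τ ^ 2 / (2 * (s * v + M * τ / 3)))) := by
        rw [← mul_assoc, ← Real.exp_nat_mul, ← Real.exp_add, mul_comm]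
        congr 2
        rw [h1, hθ]
        field_simp
        ring

end Bernstein

end MatrixBernstein

/-! ### Spectral norm, Hermitian dilation and independent sampling -/

section Dilation

variable {n : ℕ}

theorem specNorm_nonneg (X : Matrix (Fin n) (Fin n) ℝ) : 0 ≤ specNorm X := norm_nonneg _

theorem specNorm_smul (c : ℝ) (X : Matrix (Fin n) (Fin n) ℝ) :
    specNorm (c • X) = |c| * specNorm X := by
  rw [specNorm, map_smul, norm_smul, Real.norm_eq_abs, specNorm]

theorem specNorm_sub_le (X Y : Matrix (Fin n) (Fin n) ℝ) :
    specNorm (X - Y) ≤ specNorm X + specNorm Y := by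
  rw [specNorm, map_sub]; exact norm_sub_le _ _

theorem frobSq_nonneg (X : Matrix (Fin n) (Fin n) ℝ) : 0 ≤ frobSq X :=
  Finset.sum_nonneg fun _ _ => Finset.sum_nonneg fun _ _ => sq_nonneg _

theorem sq_le_frobSq (X : Matrix (Fin n) (Fin n) ℝ) (i j : Fin n) : X i j ^ 2 ≤ frobSq X :=
  (Finset.single_le_sum (f := fun j => X i j ^ 2) (fun _ _ => sq_nonneg _)
    (Finset.mem_univ j)).trans
    (Finset.single_le_sum (f := fun i => ∑ j, X i j ^ 2)
      (fun _ _ => Finset.sum_nonneg fun _ _ => sq_nonneg _) (Finset.mem_univ i))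

/-- The spectral norm is at most the Frobenius norm. -/
theorem specNorm_le_sqrt_frobSq (X : Matrix (Fin n) (Fin n) ℝ) :
    specNorm X ≤ Real.sqrt (frobSq X) := by
  refine ContinuousLinearMap.opNorm_le_bound _ (Real.sqrt_nonneg _) fun y => ?_
  rw [← Real.sqrt_sq (norm_nonneg y), ← Real.sqrt_mul (frobSq_nonneg X),
    ← Real.sqrt_sq (norm_nonneg (toEuclideanCLM (𝕜 := ℝ) X y))]
  refine Real.sqrt_le_sqrt ?_
  rw [EuclideanSpace.real_norm_sq_eq, EuclideanSpace.real_norm_sq_eq, frobSq, Finset.sum_mul]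
  refine Finset.sum_le_sum fun i _ => ?_
  rw [ofLp_toEuclideanCLM]
  exact Finset.sum_mul_sq_le_sq_mul_sq Finset.univ (X i) y.ofLp

/-- The Hermitian dilation of a matrix, a symmetric matrix of twice the size whose eigenvalues are
the singular values of the matrix and their negatives. -/
def dilation (X : Matrix (Fin n) (Fin n) ℝ) : Matrix (Fin n ⊕ Fin n) (Fin n ⊕ Fin n) ℝ :=
  fromBlocks 0 X Xᵀ 0

theorem transpose_dilation (X : Matrix (Fin n) (Fin n) ℝ) : (dilation X)ᵀ = dilation X := by
  simp [dilation, fromBlocks_transpose]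

theorem dilation_zero : dilation (0 : Matrix (Fin n) (Fin n) ℝ) = 0 := by
  simp [dilation]

theorem dilation_sub (X Y : Matrix (Fin n) (Fin n) ℝ) :
    dilation (X - Y) = dilation X - dilation Y := by
  simp [dilation, sub_eq_add_neg, fromBlocks_neg, fromBlocks_add]

theorem dilation_smul (c : ℝ) (X : Matrix (Fin n) (Fin n) ℝ) :
    dilation (c • X) = c • dilation X := by
  simp [dilation, fromBlocks_smul]

theorem dilation_sum {ι : Type*} (u : Finset ι) (X : ι → Matrix (Fin n) (Fin n) ℝ) :
    dilation (∑ i ∈ u, X i) = ∑ i ∈ u, dilation (X i) := by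
  classical
  induction u using Finset.induction_on with
  | empty => simp [dilation_zero]
  | insert a u ha ih =>
    rw [Finset.sum_insert ha, Finset.sum_insert ha, ← ih]
    simp [dilation, fromBlocks_add]

theorem dotProduct_smul_one_sub_dilation_mulVec (X : Matrix (Fin n) (Fin n) ℝ) (r : ℝ)
    (x y : Fin n → ℝ) :
    Sum.elim x y ⬝ᵥ (r • (1 : Matrix _ _ ℝ) - dilation X) *ᵥ Sum.elim x y =
      r * (x ⬝ᵥ x + y ⬝ᵥ y) - 2 * (x ⬝ᵥ X *ᵥ y) := by
  have h : y ⬝ᵥ Xᵀ *ᵥ x = x ⬝ᵥ X *ᵥ y := by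
    rw [mulVec_transpose, dotProduct_comm, dotProduct_mulVec]
  rw [sub_mulVec, smul_mulVec, one_mulVec, dilation, fromBlocks_mulVec]
  simp only [dotProduct_sub, dotProduct_smul, smul_eq_mul, sumElim_dotProduct_sumElim,
    Sum.elim_comp_inl, Sum.elim_comp_inr, zero_mulVec, zero_add, add_zero, h]
  ring

theorem isHermitian_smul_one_sub_dilation (X : Matrix (Fin n) (Fin n) ℝ) (r : ℝ) :
    (r • (1 : Matrix _ _ ℝ) - dilation X).IsHermitian := by
  rw [IsHermitian, conjTranspose_eq_transpose_of_trivial, transpose_sub, transpose_smul,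
    transpose_one, transpose_dilation]

theorem posSemidef_smul_one_sub_dilation {X : Matrix (Fin n) (Fin n) ℝ} {r : ℝ}
    (h : specNorm X ≤ r) : (r • (1 : Matrix _ _ ℝ) - dilation X).PosSemidef := by
  refine PosSemidef.of_dotProduct_mulVec_nonneg (isHermitian_smul_one_sub_dilation X r) fun w => ?_
  obtain ⟨x, y, rfl⟩ : ∃ x y, w = Sum.elim x y := ⟨_, _, (Sum.elim_comp_inl_inr w).symm⟩
  rw [star_trivial, dotProduct_smul_one_sub_dilation_mulVec]
  set x' : EuclideanSpace ℝ (Fin n) := WithLp.toLp 2 x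
  set y' : EuclideanSpace ℝ (Fin n) := WithLp.toLp 2 y
  have hx : x ⬝ᵥ x = ‖x'‖ ^ 2 := by
    rw [EuclideanSpace.real_norm_sq_eq]; simp [dotProduct, x', sq]
  have hy : y ⬝ᵥ y = ‖y'‖ ^ 2 := by
    rw [EuclideanSpace.real_norm_sq_eq]; simp [dotProduct, y', sq]
  have hxy : x ⬝ᵥ X *ᵥ y ≤ ‖x'‖ * (r * ‖y'‖) := by
    have h1 := inner_toEuclideanCLM X x' y'
    change _ = x ⬝ᵥ X *ᵥ y at h1
    rw [← h1]
    refine (real_inner_le_norm _ _).trans (mul_le_mul_of_nonneg_left ?_ (norm_nonneg _))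
    exact (ContinuousLinearMap.le_opNorm _ _).trans
      (mul_le_mul_of_nonneg_right h (norm_nonneg _))
  have hr : 0 ≤ r := (specNorm_nonneg X).trans h
  rw [hx, hy]
  nlinarith [mul_nonneg hr (sq_nonneg (‖x'‖ - ‖y'‖))]

theorem specNorm_le_of_posSemidef {X : Matrix (Fin n) (Fin n) ℝ} {r : ℝ} (hr : 0 ≤ r)
    (h : (r • (1 : Matrix _ _ ℝ) - dilation X).PosSemidef) : specNorm X ≤ r := by
  refine ContinuousLinearMap.opNorm_le_bound _ hr fun y => ?_
  set z : EuclideanSpace ℝ (Fin n) := toEuclideanCLM (𝕜 := ℝ) X y with hz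
  -- the vectors `‖y‖ • X y` and `‖X y‖ • y` have equal norms, which makes the test sharp
  have h1 := h.dotProduct_mulVec_nonneg (Sum.elim (‖y‖ • z.ofLp) (‖z‖ • y.ofLp))
  have hzz : z.ofLp ⬝ᵥ z.ofLp = ‖z‖ ^ 2 := by
    rw [EuclideanSpace.real_norm_sq_eq]; simp [dotProduct, sq]
  have hyy : y.ofLp ⬝ᵥ y.ofLp = ‖y‖ ^ 2 := by
    rw [EuclideanSpace.real_norm_sq_eq]; simp [dotProduct, sq]
  have hXy : X *ᵥ y.ofLp = z.ofLp := by rw [hz, ofLp_toEuclideanCLM]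
  rw [star_trivial, dotProduct_smul_one_sub_dilation_mulVec, mulVec_smul, hXy] at h1
  simp only [dotProduct_smul, smul_dotProduct, smul_eq_mul, hzz, hyy] at h1
  rcases (norm_nonneg z).eq_or_lt with h0 | h0
  · rw [← h0]; positivity
  rcases (norm_nonneg y).eq_or_lt with h0' | h0'
  · have : y = 0 := norm_eq_zero.1 h0'.symm
    simp [hz, this]
  refine le_of_mul_le_mul_left ?_ (show 0 < ‖y‖ * ‖z‖ ^ 2 by positivity)
  linarith

section Sampling

variable {Ω : Type*} [MeasurableSpace Ω] {ι : Type*} [Fintype ι] [MeasurableSpace ι]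
  [MeasurableSingletonClass ι]

open Classical in
/-- A union bound over the finitely many outcomes turns a bound on the total weight of the bad
outcomes into a lower bound on the probability of the good event, measurable or not. -/
theorem ofReal_one_sub_le_measure {μ : Measure Ω} [IsProbabilityMeasure μ] {s : ℕ}
    {idx : Fin s → Ω → ι} (hind : iIndepFun idx μ) {p : ι → ℝ} (hp : ∀ i, 0 ≤ p i)
    (hlaw : ∀ t i, μ (idx t ⁻¹' {i}) = ENNReal.ofReal (p i)) (P : (Fin s → ι) → Prop) {δ : ℝ}
    (h : ∑ f : Fin s → ι, (∏ t, p (f t)) * (if P f then 0 else 1) ≤ δ) :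
    ENNReal.ofReal (1 - δ) ≤ μ {ω | P fun t => idx t ω} := by
  have hterm : ∀ f : Fin s → ι, 0 ≤ (∏ t, p (f t)) * (if P f then (0 : ℝ) else 1) := fun f =>
    mul_nonneg (Finset.prod_nonneg fun t _ => hp _) (by split_ifs <;> norm_num)
  have hδ : 0 ≤ δ := (Finset.sum_nonneg fun f _ => hterm f).trans h
  have hbad : μ {ω | P fun t => idx t ω}ᶜ ≤ ENNReal.ofReal δ := by
    have hsub : {ω | P fun t => idx t ω}ᶜ ⊆
        ⋃ f ∈ Finset.univ.filter (fun f : Fin s → ι => ¬ P f), ⋂ t ∈ Finset.univ, idx t ⁻¹' {f t} :=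
      fun ω hω => Set.mem_biUnion (x := fun t => idx t ω) (by simpa using hω) (by simp)
    refine (measure_mono hsub).trans ((measure_biUnion_finset_le _ _).trans ?_)
    refine le_trans ?_ (ENNReal.ofReal_le_ofReal h)
    rw [ENNReal.ofReal_sum_of_nonneg fun f _ => hterm f, Finset.sum_filter]
    refine Finset.sum_le_sum fun f _ => ?_
    by_cases hf : P f
    · simp [hf]
    · rw [if_pos hf, if_neg hf, mul_one, ENNReal.ofReal_prod_of_nonneg fun t _ => hp _,
        hind.measure_inter_preimage_eq_mul Finset.univ fun t _ => measurableSet_singleton _]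
      exact (Finset.prod_congr rfl fun t _ => hlaw _ _).le
  rw [ENNReal.ofReal_sub 1 hδ, ENNReal.ofReal_one, tsub_le_iff_right]
  calc (1 : ENNReal) = μ ({ω | P fun t => idx t ω} ∪ {ω | P fun t => idx t ω}ᶜ) := by
        rw [Set.union_compl_self, measure_univ]
    _ ≤ μ {ω | P fun t => idx t ω} + μ {ω | P fun t => idx t ω}ᶜ := measure_union_le _ _
    _ ≤ _ := add_le_add le_rfl hbad

end Sampling

end Dilation

/-! ### The sampled entries of the truncated matrix -/

section Deviation

variable {n : ℕ}

/-- The deviation from `B` of one rescaled sampled entry of `B`, where the pair `ij` is sampled with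
probability `B i j ^ 2 / frobSq B`. The rescaled entry is `0` where `B` vanishes. -/
def deviation (B : Matrix (Fin n) (Fin n) ℝ) (ij : Fin n × Fin n) : Matrix (Fin n) (Fin n) ℝ :=
  (B ij.1 ij.2 / (B ij.1 ij.2 ^ 2 / frobSq B)) • Matrix.single ij.1 ij.2 (1 : ℝ) - B

theorem frobSq_pos {B : Matrix (Fin n) (Fin n) ℝ} (hB : B ≠ 0) : 0 < frobSq B := by
  by_contra h
  refine hB (Matrix.ext fun i j => ?_)
  have := sq_le_frobSq B i j
  exact pow_eq_zero_iff two_ne_zero |>.1 (le_antisymm (by linarith) (sq_nonneg _))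

theorem sum_sq_div_frobSq {B : Matrix (Fin n) (Fin n) ℝ} (hB : B ≠ 0) :
    ∑ ij : Fin n × Fin n, B ij.1 ij.2 ^ 2 / frobSq B = 1 := by
  rw [← Finset.sum_div, Fintype.sum_prod_type]
  exact div_self (frobSq_pos hB).ne'

theorem sum_smul_rescaled_single {B : Matrix (Fin n) (Fin n) ℝ} (hB : B ≠ 0) :
    ∑ ij : Fin n × Fin n, (B ij.1 ij.2 ^ 2 / frobSq B) •
      ((B ij.1 ij.2 / (B ij.1 ij.2 ^ 2 / frobSq B)) • Matrix.single ij.1 ij.2 (1 : ℝ)) = B := by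
  have hF := (frobSq_pos hB).ne'
  rw [Fintype.sum_prod_type]
  conv_rhs => rw [matrix_eq_sum_single B]
  refine Finset.sum_congr rfl fun i _ => Finset.sum_congr rfl fun j _ => ?_
  rw [smul_smul, smul_single, smul_eq_mul, mul_one]
  congr 1
  rcases eq_or_ne (B i j) 0 with h | h
  · simp [h]
  · field_simp

theorem sum_smul_deviation {B : Matrix (Fin n) (Fin n) ℝ} (hB : B ≠ 0) :
    ∑ ij : Fin n × Fin n, (B ij.1 ij.2 ^ 2 / frobSq B) • deviation B ij = 0 := by
  simp only [deviation, smul_sub, Finset.sum_sub_distrib, sum_smul_rescaled_single hB]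
  rw [← Finset.sum_smul, sum_sq_div_frobSq hB, one_smul, sub_self]

theorem frobSq_single (i j : Fin n) : frobSq (Matrix.single i j (1 : ℝ)) = 1 := by
  simp only [frobSq, Matrix.single_apply]
  rw [Finset.sum_eq_single i, Finset.sum_eq_single j] <;> simp +contextual [eq_comm]

/-- Entries that do not vanish are at least `a` in absolute value, so their rescaling is at most
`frobSq B / a`. -/
theorem specNorm_deviation_le {B : Matrix (Fin n) (Fin n) ℝ} {a : ℝ} (ha : 0 < a)
    (hBa : ∀ i j, B i j ≠ 0 → a ≤ |B i j|) (ij : Fin n × Fin n) :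
    specNorm (deviation B ij) ≤ frobSq B / a + Real.sqrt (frobSq B) := by
  refine (specNorm_sub_le _ _).trans (add_le_add ?_ (specNorm_le_sqrt_frobSq B))
  have h1 : specNorm (Matrix.single ij.1 ij.2 (1 : ℝ)) ≤ 1 := by
    simpa [frobSq_single] using specNorm_le_sqrt_frobSq (Matrix.single ij.1 ij.2 (1 : ℝ))
  rw [specNorm_smul]
  refine (mul_le_of_le_one_right (abs_nonneg _) h1).trans ?_
  rcases eq_or_ne (B ij.1 ij.2) 0 with h | h
  · rw [h, zero_div, abs_zero]
    exact div_nonneg (frobSq_nonneg B) ha.le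
  · have he : B ij.1 ij.2 / (B ij.1 ij.2 ^ 2 / frobSq B) = frobSq B / B ij.1 ij.2 := by
      field_simp
    rw [he, abs_div, abs_of_nonneg (frobSq_nonneg B)]
    exact div_le_div_of_nonneg_left (frobSq_nonneg B) ha (hBa _ _ h)

theorem dilation_single_mul_self (i j : Fin n) :
    dilation (Matrix.single i j (1 : ℝ)) * dilation (Matrix.single i j (1 : ℝ)) =
      diagonal (Sum.elim (Pi.single i 1) (Pi.single j 1)) := by
  rw [dilation, fromBlocks_multiply, ← fromBlocks_diagonal, Matrix.diagonal_single,
    Matrix.diagonal_single]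
  simp [transpose_single]

theorem sum_diagonal_sumElim_single :
    ∑ ij : Fin n × Fin n, diagonal (Sum.elim (Pi.single ij.1 (1 : ℝ)) (Pi.single ij.2 (1 : ℝ))) =
      (n : ℝ) • (1 : Matrix (Fin n ⊕ Fin n) (Fin n ⊕ Fin n) ℝ) := by
  have h : ∑ ij : Fin n × Fin n, Sum.elim (Pi.single ij.1 (1 : ℝ)) (Pi.single ij.2 (1 : ℝ)) =
      fun _ : Fin n ⊕ Fin n => (n : ℝ) := by
    funext k
    rw [Finset.sum_apply, Fintype.sum_prod_type]
    cases k <;> simp [Pi.single_apply]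
  rw [smul_one_eq_diagonal, ← h]
  exact (map_sum (diagonalAddMonoidHom (Fin n ⊕ Fin n) ℝ) _ _).symm

/-- The second moment of the dilated deviation is at most `n * frobSq B`: centring only lowers it,
and each entry contributes `frobSq B` at one diagonal position of each block. -/
theorem posSemidef_second_moment {B : Matrix (Fin n) (Fin n) ℝ} (hB : B ≠ 0) :
    ((n * frobSq B) • (1 : Matrix (Fin n ⊕ Fin n) (Fin n ⊕ Fin n) ℝ) -
      ∑ ij : Fin n × Fin n, (B ij.1 ij.2 ^ 2 / frobSq B) •
        (dilation (deviation B ij) * dilation (deviation B ij))).PosSemidef := by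
  set F := frobSq B with hF
  have hF0 : 0 < F := frobSq_pos hB
  set p : Fin n × Fin n → ℝ := fun ij => B ij.1 ij.2 ^ 2 / F with hp
  set c : Fin n × Fin n → ℝ := fun ij => B ij.1 ij.2 / p ij with hc
  set Y : Fin n × Fin n → Matrix (Fin n ⊕ Fin n) (Fin n ⊕ Fin n) ℝ :=
    fun ij => c ij • dilation (Matrix.single ij.1 ij.2 (1 : ℝ)) with hY
  set D := dilation B with hD
  have hdev : ∀ ij, dilation (deviation B ij) = Y ij - D := fun ij => by
    rw [deviation, dilation_sub, dilation_smul]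
  have hmean : ∑ ij, p ij • Y ij = D := by
    have h := congrArg dilation (sum_smul_rescaled_single hB)
    rw [dilation_sum] at h
    simpa only [dilation_smul] using h
  have hp1 : ∑ ij, p ij = 1 := sum_sq_div_frobSq hB
  have hvar : ∑ ij, p ij • ((Y ij - D) * (Y ij - D)) = ∑ ij, p ij • (Y ij * Y ij) - D * D := by
    have hexp : ∀ ij, p ij • ((Y ij - D) * (Y ij - D)) =
        p ij • (Y ij * Y ij) - (p ij • Y ij) * D - D * (p ij • Y ij) + p ij • (D * D) := fun ij => by
      simp only [sub_mul, mul_sub, Matrix.smul_mul, Matrix.mul_smul, smul_sub]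
      abel
    simp only [hexp, Finset.sum_add_distrib, Finset.sum_sub_distrib]
    rw [← Finset.sum_mul, ← Finset.mul_sum, hmean, ← Finset.sum_smul, hp1, one_smul]
    abel
  have hYY : ∀ ij, p ij • (Y ij * Y ij) = (p ij * c ij ^ 2) •
      diagonal (Sum.elim (Pi.single ij.1 (1 : ℝ)) (Pi.single ij.2 (1 : ℝ))) := fun ij => by
    rw [hY, Matrix.smul_mul, Matrix.mul_smul, dilation_single_mul_self, smul_smul, smul_smul]
    congr 1; ring
  have hpc : ∀ ij, p ij * c ij ^ 2 ≤ F := fun ij => by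
    rcases eq_or_ne (B ij.1 ij.2) 0 with h | h
    · simp only [hc, h, zero_div, hp]; simpa using hF0.le
    · refine le_of_eq ?_
      simp only [hc, hp]
      field_simp
  have h1 : (∑ ij : Fin n × Fin n, (F - p ij * c ij ^ 2) •
      diagonal (Sum.elim (Pi.single ij.1 (1 : ℝ)) (Pi.single ij.2 (1 : ℝ)))).PosSemidef := by
    refine posSemidef_sum _ fun ij _ => (PosSemidef.diagonal fun k => ?_).smul
      (sub_nonneg.2 (hpc ij))
    cases k <;> simp only [Pi.zero_apply, Sum.elim_inl, Sum.elim_inr, Pi.single_apply] <;>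
      split_ifs <;> norm_num
  have h2 : (D * D).PosSemidef := by
    have h := posSemidef_conjTranspose_mul_self D
    rwa [conjTranspose_eq_transpose_of_trivial, hD, transpose_dilation] at h
  have key : (n * F) • (1 : Matrix (Fin n ⊕ Fin n) (Fin n ⊕ Fin n) ℝ) -
      ∑ ij, p ij • (dilation (deviation B ij) * dilation (deviation B ij)) =
      (∑ ij : Fin n × Fin n, (F - p ij * c ij ^ 2) •
        diagonal (Sum.elim (Pi.single ij.1 (1 : ℝ)) (Pi.single ij.2 (1 : ℝ)))) + D * D := by
    simp only [hdev, hvar, hYY, sub_smul, Finset.sum_sub_distrib]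
    rw [← Finset.smul_sum, sum_diagonal_sumElim_single, smul_smul, mul_comm F]
    abel
  rw [key]
  exact h1.add h2

theorem sum_deviation_eq {A : Matrix (Fin n) (Fin n) ℝ} {e : ℝ} {s : ℕ} (hs : 0 < s)
    (f : Fin s → Fin n × Fin n) :
    ∑ t, deviation (truncate A e) (f t) = (s : ℝ) • (sketch A e f - truncate A e) := by
  have hs' : (s : ℝ) ≠ 0 := by exact_mod_cast hs.ne'
  simp only [deviation, Finset.sum_sub_distrib, sketch, sampProb]
  rw [smul_sub, smul_smul, mul_one_div_cancel hs', one_smul, Finset.sum_const, Finset.card_univ,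
    Fintype.card_fin, Nat.cast_smul_eq_nsmul]

/-- Truncation changes each of the `n ^ 2` entries by at most `e / (2 n)`. -/
theorem specNorm_sub_truncate_le (hn : 1 ≤ n) (A : Matrix (Fin n) (Fin n) ℝ) {e : ℝ}
    (he : 0 ≤ e) : specNorm (A - truncate A e) ≤ e / 2 := by
  have hn' : (0 : ℝ) < n := by exact_mod_cast hn
  refine (specNorm_le_sqrt_frobSq _).trans ((Real.sqrt_le_left (by positivity)).2 ?_)
  calc frobSq (A - truncate A e) ≤ ∑ _i : Fin n, ∑ _j : Fin n, (e / (2 * n)) ^ 2 := by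
        refine Finset.sum_le_sum fun i _ => Finset.sum_le_sum fun j _ => sq_le_sq' ?_ ?_ <;>
          simp only [Matrix.sub_apply, truncate, of_apply] <;> split_ifs with h
        · rw [sub_zero]; exact (abs_lt.1 h).1.le
        · rw [sub_self, neg_nonpos]; positivity
        · rw [sub_zero]; exact (abs_lt.1 h).2.le
        · rw [sub_self]; positivity
    _ = (e / 2) ^ 2 := by
        simp only [Finset.sum_const, Finset.card_univ, Fintype.card_fin, nsmul_eq_mul]
        field_simp

theorem le_abs_truncate {A : Matrix (Fin n) (Fin n) ℝ} {e : ℝ} (i j : Fin n)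
    (h : truncate A e i j ≠ 0) : e / (2 * n) ≤ |truncate A e i j| := by
  simp only [truncate, of_apply] at h ⊢
  split_ifs with h'
  · simp [h'] at h
  · exact not_lt.1 h'

theorem frobSq_truncate_le (A : Matrix (Fin n) (Fin n) ℝ) (e : ℝ) :
    frobSq (truncate A e) ≤ frobSq A := by
  refine Finset.sum_le_sum fun i _ => Finset.sum_le_sum fun j _ => ?_
  simp only [truncate, of_apply]
  split_ifs
  · simpa using sq_nonneg (A i j)
  · exact le_rfl

/-- The exponent of Bernstein's inequality for the sampling step. The bound `e ≤ 2 * n * q` on the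
accuracy absorbs the centring term into the variance. -/
theorem two_mul_le_bernstein_exponent {N q e s L : ℝ} (hN : 0 < N) (hq : 0 < q) (he : 0 < e)
    (hs : 0 < s) (hL : 0 ≤ L) (heq : e ≤ 2 * N * q) (h : 28 * N * q ^ 2 * L ≤ s * e ^ 2) :
    2 * L ≤ (s * (e / 2)) ^ 2 /
      (2 * (s * (N * q ^ 2) + (q ^ 2 / (e / (2 * N)) + q) * (s * (e / 2)) / 3)) := by
  have h1 : (q ^ 2 / (e / (2 * N)) + q) * (s * (e / 2)) = s * (N * q ^ 2) + s * q * e / 2 := by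
    field_simp
  rw [h1, le_div_iff₀ (by positivity)]
  have h2 : s * q * e ≤ s * q * (2 * N * q) := mul_le_mul_of_nonneg_left heq (by positivity)
  have h3 : 2 * (s * (N * q ^ 2) + (s * (N * q ^ 2) + s * q * e / 2) / 3) ≤
      10 / 3 * (s * (N * q ^ 2)) := by nlinarith
  calc 2 * L * (2 * (s * (N * q ^ 2) + (s * (N * q ^ 2) + s * q * e / 2) / 3))
      ≤ 2 * L * (10 / 3 * (s * (N * q ^ 2))) := mul_le_mul_of_nonneg_left h3 (by positivity)
    _ ≤ s / 4 * (28 * N * q ^ 2 * L) := by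
        have : 0 ≤ L * (s * (N * q ^ 2)) := by positivity
        nlinarith
    _ ≤ s / 4 * (s * e ^ 2) := mul_le_mul_of_nonneg_left h (by positivity)
    _ = (s * (e / 2)) ^ 2 := by ring

theorem two_mul_exp_neg_two_log (hn : 1 ≤ n) :
    (2 * n : ℝ) * Real.exp (-(2 * Real.log (Real.sqrt 2 * n))) = 1 / n := by
  have hn' : (0 : ℝ) < n := by exact_mod_cast hn
  have h : 2 * Real.log (Real.sqrt 2 * n) = Real.log (2 * n ^ 2) := by
    rw [← Real.log_rpow (by positivity), Real.rpow_two, mul_pow, Real.sq_sqrt (by norm_num)]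
  rw [h, Real.exp_neg, Real.exp_log (by positivity)]
  field_simp

end Deviation

end Sparsification

end

theorem corollary1 {n : ℕ} (hn : 1 ≤ n) (A : Matrix (Fin n) (Fin n) ℝ) (ε : ℝ) (hε : 0 < ε)
    (s : ℕ)
    (hs : 28 * (n : ℝ) * Sparsification.stableRank A * Real.log (Real.sqrt 2 * (n : ℝ)) / ε ^ 2
      ≤ (s : ℝ))
    {Ω : Type*} [MeasurableSpace Ω] (μ : Measure Ω) [IsProbabilityMeasure μ]
    (idx : Fin s → Ω → Fin n × Fin n)
    (hidx : Sparsification.IsSample μ A (ε * Sparsification.specNorm A) idx) :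
    ENNReal.ofReal (1 - 1 / (n : ℝ)) ≤
      μ {ω | Sparsification.specNorm
          (A - Sparsification.sketch A (ε * Sparsification.specNorm A) (fun t => idx t ω))
        ≤ ε * Sparsification.specNorm A} := by
  classical
  have hn' : (1 : ℝ) ≤ n := by exact_mod_cast hn
  set e := ε * Sparsification.specNorm A with he
  have he0 : 0 ≤ e := mul_nonneg hε.le (Sparsification.specNorm_nonneg A)
  have htr := Sparsification.specNorm_sub_truncate_le hn A he0
  set B := Sparsification.truncate A e with hB
  by_cases hB0 : B = 0
  · have hsk : ∀ f : Fin s → Fin n × Fin n, Sparsification.sketch A e f = 0 := fun f => by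
      simp [Sparsification.sketch, ← hB, hB0]
    rw [hB0, sub_zero] at htr
    have huniv : {ω | Sparsification.specNorm (A - Sparsification.sketch A e fun t => idx t ω) ≤ e}
        = Set.univ := by
      refine Set.eq_univ_of_forall fun ω => ?_
      rw [Set.mem_ofPred_eq, hsk, sub_zero]
      linarith
    rw [huniv, measure_univ]
    exact ENNReal.ofReal_le_one.2 (sub_le_self _ (by positivity))
  have hF : 0 < Sparsification.frobSq B := Sparsification.frobSq_pos hB0
  have hFA : Sparsification.frobSq B ≤ Sparsification.frobSq A :=
    Sparsification.frobSq_truncate_le A e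
  have hσ : 0 < Sparsification.specNorm A := by
    refine (Sparsification.specNorm_nonneg A).lt_of_ne fun h => ?_
    have hA : A = 0 := by
      have h0 := norm_eq_zero.1 h.symm
      exact (map_eq_zero_iff _ (Matrix.toEuclideanCLM (𝕜 := ℝ) (n := Fin n)).injective).1 h0
    refine hB0 (Matrix.ext fun i j => ?_)
    simp [hB, Sparsification.truncate, hA]
  have he0' : 0 < e := mul_pos hε hσ
  set L := Real.log (Real.sqrt 2 * (n : ℝ)) with hL
  have hL0 : 0 < L := by
    refine Real.log_pos ?_
    have : (1 : ℝ) < Real.sqrt 2 := by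
      rw [Real.lt_sqrt zero_le_one]; norm_num
    nlinarith
  have hs1 : 28 * n * Sparsification.frobSq A * L ≤ s * e ^ 2 := by
    rw [div_le_iff₀ (by positivity), Sparsification.stableRank] at hs
    have h := mul_le_mul_of_nonneg_right hs (sq_nonneg (Sparsification.specNorm A))
    have h' : 28 * (n : ℝ) * (Sparsification.frobSq A / Sparsification.specNorm A ^ 2) * L *
        Sparsification.specNorm A ^ 2 = 28 * n * Sparsification.frobSq A * L := by
      field_simp
    rw [h'] at h
    refine h.trans_eq ?_
    rw [he]; ring
  have hs0 : (0 : ℝ) < s := by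
    have h : 0 < s * e ^ 2 := lt_of_lt_of_le (by have := hF.trans_le hFA; positivity) hs1
    exact pos_of_mul_pos_left h (sq_nonneg e)
  have hsN : 0 < s := by exact_mod_cast hs0
  set q := Real.sqrt (Sparsification.frobSq B) with hq
  have hq2 : q ^ 2 = Sparsification.frobSq B := Real.sq_sqrt hF.le
  have hq0 : 0 < q := Real.sqrt_pos.2 hF
  have heq : e ≤ 2 * n * q := by
    obtain ⟨i, j, hij⟩ : ∃ i j, B i j ≠ 0 := by
      by_contra! h
      exact hB0 (Matrix.ext h)
    have h1 : e / (2 * n) ≤ |B i j| := Sparsification.le_abs_truncate i j hij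
    have h2 : |B i j| ≤ q := Real.abs_le_sqrt (Sparsification.sq_le_frobSq B i j)
    have h3 := (div_le_iff₀ (by positivity)).1 (h1.trans h2)
    linarith
  have hprod : 28 * (n : ℝ) * q ^ 2 * L ≤ s * e ^ 2 := by
    refine le_trans ?_ hs1
    rw [hq2]
    gcongr
  have hbern := Sparsification.matrix_bernstein
    (p := fun ij : Fin n × Fin n => B ij.1 ij.2 ^ 2 / Sparsification.frobSq B)
    (Z := fun ij => Sparsification.dilation (Sparsification.deviation B ij))
    (M := Sparsification.frobSq B / (e / (2 * n)) + q) (τ := s * (e / 2))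
    (fun ij => div_nonneg (sq_nonneg _) hF.le) (Sparsification.sum_sq_div_frobSq hB0)
    (fun ij => Sparsification.transpose_dilation _)
    (by
      simp only [← Sparsification.dilation_smul, ← Sparsification.dilation_sum,
        Sparsification.sum_smul_deviation hB0, Sparsification.dilation_zero])
    (fun ij => Sparsification.posSemidef_smul_one_sub_dilation
      (Sparsification.specNorm_deviation_le (by positivity) Sparsification.le_abs_truncate ij))
    (Sparsification.posSemidef_second_moment hB0) (by positivity) (by positivity) hsN
    (by positivity)
  have hexp := Sparsification.two_mul_le_bernstein_exponent (by positivity) hq0 he0' hs0 hL0.le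
    heq hprod
  rw [hq2] at hexp
  have hδ := hbern.trans (mul_le_mul_of_nonneg_left
    (Real.exp_le_exp.2 (neg_le_neg hexp)) (Nat.cast_nonneg _))
  have hcard : ((Fintype.card (Fin n ⊕ Fin n) : ℕ) : ℝ) = 2 * n := by
    rw [Fintype.card_sum, Fintype.card_fin]; push_cast; ring
  rw [hcard, Sparsification.two_mul_exp_neg_two_log hn] at hδ
  refine (Sparsification.ofReal_one_sub_le_measure hidx.indep
    (fun ij => div_nonneg (sq_nonneg _) hF.le)
    (fun t ij => hidx.law hB0 t ij.1 ij.2) _ hδ).trans (measure_mono fun ω hω => ?_)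
  simp only [Set.mem_ofPred_eq, ← Sparsification.dilation_sum] at hω ⊢
  have h1 := Sparsification.specNorm_le_of_posSemidef (by positivity) hω
  rw [hB, Sparsification.sum_deviation_eq hsN, Sparsification.specNorm_smul, abs_of_pos hs0,
    mul_le_mul_iff_right₀ hs0, ← hB] at h1
  have h2 := Sparsification.specNorm_sub_le (A - B)
    (Sparsification.sketch A e (fun t => idx t ω) - B)
  rw [sub_sub_sub_cancel_right] at h2
  linarith
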